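/- Let $d,\gamma\ge 1$ be integers. For $L>0$ put $\Omega_L=[-L,L]^d$, $\mathcal F_Lg(k)=(2L)^{-d}\int_{\Omega_L}g(x)e^{-i\pi k\cdot x/L}\,dx$ for $k\in\mathbb Z^d$, and $P_{L,N}g(x)=\sum_{|k|_\infty\le N}\mathcal F_Lg(k)\,e^{i\pi k\cdot x/L}$; let $E$ denote the extension of a function from $\Omega_L$ to $\mathbb R^d$ by zero, and $\|f\|_{H^\gamma(\mathbb R^d)}=\|(1-\Delta)^{\gamma/2}f\|_{L^2(\mathbb R^d)}$. For $a\in(0,1)$, an $a$-cutoff is a real-valued $\chi_{a,1}\in C_c^\infty(\mathbb R^d)$ with $\chi_{a,1}=1$ on $(-a,a)^d$ and $\operatorname{supp}\chi_{a,1}\subset(-1,1)^d$; put $\chi_{a,L}(x)=\chi_{a,1}(x/L)$. We say that $\chi_{a,1}$ has layer constant $K$ up to order $m$ if $\|D^j\chi_{a,1}(x)\|\le K(1-a)^{-j}$ for all $x\in\mathbb R^d$ and $0\le j\le m$. Consider the estimate $$\|f-E P_{L,N}(\chi_{a,L}f)\|_{L^2(\mathbb R^d)}\le C(aL)^{-\gamma}\,\||x|^\gamma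 f\|_{L^2(\mathbb R^d)}+C\bigl(1+((1-a)L)^{-\gamma}\bigr)(NL^{-1})^{-\gamma}\,\|f\|_{H^\gamma(\mathbb R^d)}.\qquad(*)$$ 1. For every $K$ there is a constant $C>0$, depending only on $d$, $\gamma$ and $K$ (in particular independent of $L$, $a$, $N$ and $f$), such that $(*)$ holds for all $a\in(0,1)$, all $a$-cutoffs $\chi_{a,1}$ with layer constant $K$ up to order $\gamma$, all $L>0$, all integers $N\ge1$ and all complex-valued $f\in H^\gamma(\mathbb R^d)\cap L^2(\mathbb R^d;|x|^{2\gamma}dx)$. 2. For every $a\in(0,1)$ and every $a$-cutoff $\chi_{a,1}$ there is a constant $C>0$ such that $(*)$ holds for all $L>0$, all integers $N\ge1$ and all $f\in H^\gamma(\mathbb R^d)\cap L^2(\mathbb R^d;|x|^{2\gamma}dx)$. 3. There is a family $(\chi_{a,1})_{0<a<1}$ of $a$-cutoffs with values in $[0,1]$ that has, for every $m\ge 0$, a layer constant up to order $m$ that does not depend on $a$. By part 1, $(*)$ holds for this family with a single constant $C$ for all $a$, $L$, $N$ and $f$. -/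

import Mathlib

open MeasureTheory Set
open scoped FourierTransform ENNReal

noncomputable section

namespace WindowApprox

/-- Euclidean space `ℝ^d`. -/
abbrev E (d : ℕ) : Type := EuclideanSpace ℝ (Fin d)

/-- The complex Hilbert space `L²(ℝ^d)` with respect to Lebesgue measure. -/
abbrev L2 (d : ℕ) : Type := Lp ℂ 2 (volume : Measure (E d))

/-- The open cube `(-r, r)^d`. -/
def openCube (d : ℕ) (r : ℝ) : Set (E d) := {x | ∀ i, |x i| < r}

/-- The computational window `Ω_L = [-L, L]^d`. -/
def window (d : ℕ) (L : ℝ) : Set (E d) := {x | ∀ i, |x i| ≤ L}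

/-- The symbol `(1 + |2πξ|²)^{s/2}`. The Fourier transform of Mathlib has the kernel
`e^{-2πi x·ξ}`, so that `2πξ` is the angular frequency and multiplication by this symbol on the
Fourier side is the operator `(1 - Δ)^{s/2}`. -/
def besselSymbol {d : ℕ} (s : ℝ) (ξ : E d) : ℝ :=
  (1 + (2 * Real.pi * ‖ξ‖) ^ 2) ^ (s / 2)

/-- `f ∈ L²(ℝ^d)` belongs to the Sobolev space `H^s(ℝ^d)`. -/
def MemH {d : ℕ} (s : ℝ) (f : L2 d) : Prop :=
  MemLp (fun ξ => besselSymbol s ξ • (𝓕 f : L2 d) ξ) 2 volume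

/-- The Bessel potential `J^s f = 𝓕⁻¹[(1 + |2πξ|²)^{s/2} 𝓕 f]` of `f ∈ H^s(ℝ^d)`, `s ≥ 0`. -/
def besselPotential {d : ℕ} (s : ℝ) (f : L2 d) (hf : MemH s f) : L2 d :=
  𝓕⁻ (MemLp.toLp _ hf)

/-- The Sobolev norm `‖f‖_{H^s} = ‖J^s f‖_{L²}`. -/
def sobolevNorm {d : ℕ} (s : ℝ) (f : L2 d) (hf : MemH s f) : ℝ :=
  ‖besselPotential s f hf‖

/-- The Fourier mode `e^{iπ k·x/L}`. -/
def mode {d : ℕ} (L : ℝ) (k : Fin d → ℤ) (x : E d) : ℂ :=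
  Complex.exp (Complex.I * ((Real.pi * (∑ i, (k i : ℝ) * x i) / L : ℝ) : ℂ))

/-- The Fourier coefficient `(2L)^{-d} ∫_{Ω_L} g(x) e^{-iπ k·x/L} dx` on the torus `Ω_L`. -/
def fourierCoeffWindow {d : ℕ} (L : ℝ) (g : E d → ℂ) (k : Fin d → ℤ) : ℂ :=
  (((2 * L) ^ d)⁻¹ : ℝ) • ∫ x in window d L, g x * mode L (-k) x

/-- The projection of `g` onto the modes with `|k|_∞ ≤ N`. -/
def fourierProj {d : ℕ} (L : ℝ) (N : ℕ) (g : E d → ℂ) (x : E d) : ℂ :=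
  ∑ k ∈ Finset.Icc (fun _ : Fin d => -(N : ℤ)) (fun _ => (N : ℤ)),
    fourierCoeffWindow L g k * mode L k x

/-- Zero extension from `Ω_L` to `ℝ^d`. -/
def zeroExt {d : ℕ} (L : ℝ) (g : E d → ℂ) : E d → ℂ := (window d L).indicator g

/-- `χ` is a smooth cut-off function with parameter `a`: `χ ∈ C_c^∞`, `χ = 1` on `(-a,a)^d` and
`supp χ ⊂ (-1,1)^d`. -/
structure IsCutoff {d : ℕ} (a : ℝ) (χ : E d → ℝ) : Prop where
  smooth : ContDiff ℝ (⊤ : ℕ∞) χ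
  hasCompactSupport : HasCompactSupport χ
  eq_one : ∀ x ∈ openCube d a, χ x = 1
  support_subset : tsupport χ ⊆ openCube d 1

/-- The derivatives of `χ` of order at most `m` obey the natural scaling in the width `1 - a` of
the transition layer, with constant `K`. -/
def LayerBound {d : ℕ} (m : ℕ) (K a : ℝ) (χ : E d → ℝ) : Prop :=
  ∀ j ≤ m, ∀ x, ‖iteratedFDeriv ℝ j χ x‖ ≤ K * (1 - a) ^ (-(j : ℤ))

/-- The dilated cut-off `χ_{a,L}(x) = χ_{a,1}(x / L)`. -/
def dilate {d : ℕ} (L : ℝ) (χ : E d → ℝ) (x : E d) : ℝ := χ (L⁻¹ • x)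

/-- The approximation of `f` by the zero extension of the Fourier projection of `χ_{a,L} f`. -/
def windowApprox {d : ℕ} (L : ℝ) (N : ℕ) (χ : E d → ℝ) (f : E d → ℂ) : E d → ℂ :=
  zeroExt L (fourierProj L N (fun x => dilate L χ x • f x))

/-- The error estimate, with constant `C`, for all window sizes `L > 0`, all `N ≥ 1` and all
`f ∈ H^γ(ℝ^d) ∩ L²(ℝ^d; |x|^{2γ} dx)`. -/
def ApproxEstimate (d γ : ℕ) (C a : ℝ) (χ : E d → ℝ) : Prop :=
  ∀ L : ℝ, 0 < L → ∀ N : ℕ, 1 ≤ N → ∀ (f : L2 d) (hf : MemH (γ : ℝ) f),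
    MemLp (fun x => ‖x‖ ^ γ • f x) 2 volume →
    eLpNorm (fun x => f x - windowApprox L N χ f x) 2 volume ≤
      ENNReal.ofReal
        (C * (a * L) ^ (-(γ : ℤ)) * (eLpNorm (fun x => ‖x‖ ^ γ • f x) 2 volume).toReal
          + C * (1 + ((1 - a) * L) ^ (-(γ : ℤ))) * ((N : ℝ) * L⁻¹) ^ (-(γ : ℤ))
            * sobolevNorm (γ : ℝ) f hf)

end WindowApprox

end

/-!
The error splits as `f - E P(χ f) = (1 - χ) f + (χ f - E P(χ f))`, where `χ` is the dilated cut-off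
and `P` the projection on the frequencies `|k|_∞ ≤ N`.

The first term lives where `‖x‖ ≥ a L`, so the weight `‖x‖^γ` pays for it
(`eLpNorm_sub_dilate_smul_le`).

For the second term, Parseval's identity on the window
(`hasSum_sq_fourierCoeffWindow_sub_sum`, transported from the torus `(ℝ/ℤ)^d` by a measure
preserving chart) turns its square into the sum of the squared Fourier coefficients over
`|k|_∞ > N`. Such a `k` has a coordinate with `|k i| > N`. A function `g` that is supported in the
window has the coefficients `(2L)^{-d} 𝓕 g (k / 2L)`, so that passing to `∂_i^γ g` multiplies them
by `(iπ k i / L)^γ`, and the sum is at most `(N / L)^{-2γ} ∑ i, ‖∂_i^γ g‖²`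
(`eLpNorm_schwartz_sub_fourierProj_le`). For `g = χ φ` the product rule and Plancherel's theorem
bound `‖∂_i^γ g‖` by `K (1 + M)^γ ‖φ‖_{H^γ}` with `M = 1 / ((1 - a) L)`
(`norm_toLp_iterate_lineDerivOp_smul_le`, `norm_toLp_iterate_lineDerivOp_le`), and
`(1 + M)^γ ≤ 2^γ (1 + M^γ)`. No weak derivatives are needed: this is done for Schwartz functions
`φ`, which are dense in `H^γ` (`exists_schwartz_approx`), and the remainder `1 - P` is a contraction
of `L²` of the window, so that the estimate survives the limit
(`eLpNorm_dilate_smul_sub_fourierProj_le`).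

A fixed cut-off has some layer constant by compactness. The uniform family `cubeCutoff` is the
product over the `2d` faces of the cube of one smooth transition, rescaled to width `(1 - a) / 2`;
uniform layer bounds are stable under products (`UniformLayerBound.mul`).
-/

open MeasureTheory Set
open scoped FourierTransform ENNReal

noncomputable section

namespace WindowApprox

/-! ### Parseval's identity on the window -/

section Parseval

-- The Fourier series of Mathlib on the torus are normalised by Haar probability measure.
attribute [local instance] instMeasureSpaceUnitAddCircle

open UnitAddTorus

/-- Parseval's identity on the torus for the remainder of a partial Fourier sum. -/
theorem hasSum_sq_mFourierCoeff_sub_sum {d : ℕ} (F : UnitAddTorus (Fin d) → ℂ)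
    (hF : MemLp F 2 volume) (S : Finset (Fin d → ℤ)) :
    HasSum (fun k => if k ∈ S then 0 else ‖mFourierCoeff F k‖ ^ 2)
      (∫ y, ‖F y - ∑ k ∈ S, mFourierCoeff F k * mFourier k y‖ ^ 2) := by
  have hcoeff (k : Fin d → ℤ) : mFourierCoeff (hF.toLp F) k = mFourierCoeff F k := by
    apply integral_congr_ae
    filter_upwards [hF.coeFn_toLp] with y hy
    rw [hy]
  set G : Lp ℂ 2 (volume : Measure (UnitAddTorus (Fin d))) :=
    hF.toLp F - ∑ k ∈ S, mFourierCoeff F k • mFourierLp 2 k with hG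
  have hGcoeff (k : Fin d → ℤ) :
      mFourierCoeff G k = if k ∈ S then 0 else mFourierCoeff F k := by
    have hrepr (f : Lp ℂ 2 (volume : Measure (UnitAddTorus (Fin d)))) :
        mFourierCoeff f k = inner ℂ (mFourierLp 2 k) f := by
      rw [← mFourierBasis_repr, HilbertBasis.repr_apply_apply, coe_mFourierBasis]
    rw [hrepr, hG, inner_sub_right, inner_sum, ← hrepr, hcoeff]
    simp only [inner_smul_right, orthonormal_iff_ite.mp orthonormal_mFourier, mul_ite, mul_one,
      mul_zero, Finset.sum_ite_eq]
    split_ifs <;> simp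
  have h := hasSum_sq_mFourierCoeff G
  have hint : ∫ y, ‖G y‖ ^ 2 = ∫ y, ‖F y - ∑ k ∈ S, mFourierCoeff F k * mFourier k y‖ ^ 2 := by
    apply integral_congr_ae
    have h1 : (G : UnitAddTorus (Fin d) → ℂ) =ᵐ[volume] fun y => (hF.toLp F) y -
        (∑ k ∈ S, mFourierCoeff F k • mFourierLp 2 k :
          Lp ℂ 2 (volume : Measure (UnitAddTorus (Fin d)))) y := Lp.coeFn_sub _ _
    have h2 := Lp.coeFn_finsetSum S
      (fun k => mFourierCoeff F k • mFourierLp (d := Fin d) 2 k)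
    have h3 : ∀ᵐ y : UnitAddTorus (Fin d), ∀ k ∈ S,
        (mFourierCoeff F k • mFourierLp (d := Fin d) 2 k :
          Lp ℂ 2 (volume : Measure (UnitAddTorus (Fin d)))) y
          = mFourierCoeff F k * mFourier k y := by
      refine (ae_ball_iff S.countable_toSet).mpr fun k _ => ?_
      filter_upwards [Lp.coeFn_smul (mFourierCoeff F k) (mFourierLp (d := Fin d) 2 k),
        coeFn_mFourierLp 2 k] with y hy hy'
      rw [hy, Pi.smul_apply, hy', smul_eq_mul]
    filter_upwards [h1, h2, h3, hF.coeFn_toLp] with y h1 h2 h3 h4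
    rw [h1, h2, h4, Finset.sum_apply, Finset.sum_congr rfl h3]
  rw [hint] at h
  convert h using 2 with k
  rw [hGcoeff]
  split_ifs <;> simp

/-- The chart of the torus `(ℝ/ℤ)^d` whose range is the window `[-L, L]^d` up to null sets. -/
def torusChart (d : ℕ) (L : ℝ) (y : UnitAddTorus (Fin d)) : E d :=
  (2 * L) • WithLp.toLp 2 (fun i => (AddCircle.equivIoc 1 (-(1 / 2)) (y i) : ℝ))

theorem measurePreserving_torusChart (d : ℕ) {L : ℝ} (hL : 0 < L) :
    MeasurePreserving (torusChart d L) volume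
      (ENNReal.ofReal ((2 * L) ^ d)⁻¹ • volume.restrict (window d L)) := by
  have h1 := measurePreserving_equivPiIoc (fun _ : Fin d => (-(1 / 2) : ℝ))
  have hmeas : MeasurableSet
      {x : Fin d → ℝ | ∀ i, x i ∈ Ioc (-(1 / 2) : ℝ) (-(1 / 2) + 1)} :=
    MeasurableSet.univ_pi' fun _ => measurableSet_Ioc
  have h2 : MeasurePreserving (Subtype.val :
      {x : Fin d → ℝ // ∀ i, x i ∈ Ioc (-(1 / 2) : ℝ) (-(1 / 2) + 1)} → (Fin d → ℝ))
      (Measure.comap Subtype.val volume)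
      (volume.restrict {x : Fin d → ℝ | ∀ i, x i ∈ Ioc (-(1 / 2) : ℝ) (-(1 / 2) + 1)}) :=
    ⟨measurable_subtype_coe, map_comap_subtype_coe hmeas _⟩
  have h3 : (volume.restrict {x : Fin d → ℝ | ∀ i, x i ∈ Ioc (-(1 / 2) : ℝ) (-(1 / 2) + 1)})
      = volume.restrict (WithLp.toLp 2 ⁻¹' (window d (1 / 2)) : Set (Fin d → ℝ)) := by
    apply Measure.restrict_congr_set
    have := Measure.univ_pi_Ioc_ae_eq_Icc (μ := fun _ : Fin d => (volume : Measure ℝ))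
      (f := fun _ => (-(1 / 2) : ℝ)) (g := fun _ => (-(1 / 2) + 1 : ℝ))
    rw [volume_pi]
    have e1 : {x : Fin d → ℝ | ∀ i, x i ∈ Ioc (-(1 / 2) : ℝ) (-(1 / 2) + 1)} =
        Set.univ.pi fun _ => Ioc (-(1 / 2) : ℝ) (-(1 / 2) + 1) := by
      ext x; simp
    have e2 : (WithLp.toLp 2 ⁻¹' (window d (1 / 2)) : Set (Fin d → ℝ)) =
        Icc (fun _ => (-(1 / 2) : ℝ)) (fun _ => (-(1 / 2) + 1 : ℝ)) := by
      ext x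
      simp only [window, Set.mem_preimage, Set.mem_ofPred_eq, abs_le, Set.mem_Icc, Pi.le_def,
        ← forall_and]
      norm_num
    rw [e1, e2]
    exact this
  have h4 : MeasurePreserving (WithLp.toLp 2 : (Fin d → ℝ) → E d)
      (volume.restrict (WithLp.toLp 2 ⁻¹' (window d (1 / 2)))) (volume.restrict (window d (1 / 2))) :=
    (PiLp.volume_preserving_toLp (Fin d)).restrict_preimage_emb
      (MeasurableEquiv.toLp 2 (Fin d → ℝ)).measurableEmbedding _
  have h2L : (2 * L) ≠ 0 := by positivity
  have h5 : MeasurePreserving (fun x : E d => (2 * L) • x) volume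
      (ENNReal.ofReal ((2 * L) ^ d)⁻¹ • volume) := by
    refine ⟨measurable_const_smul _, ?_⟩
    rw [Measure.map_addHaar_smul _ h2L, finrank_euclideanSpace_fin,
      abs_of_nonneg (by positivity)]
  have h6 : MeasurePreserving (fun x : E d => (2 * L) • x) (volume.restrict (window d (1 / 2)))
      (ENNReal.ofReal ((2 * L) ^ d)⁻¹ • volume.restrict (window d L)) := by
    have h := h5.restrict_preimage_emb
      (measurableEmbedding_const_smul₀ h2L) (window d L)
    rw [Measure.restrict_smul] at h
    convert h using 2
    ext x
    simp only [window, Set.mem_preimage, Set.mem_ofPred_eq, PiLp.smul_apply, smul_eq_mul, abs_mul,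
      abs_of_pos (show 0 < 2 * L by positivity)]
    refine forall_congr' fun i => ?_
    rw [← le_div_iff₀' (by positivity)]
    rw [show L / (2 * L) = 1 / 2 by field_simp]
  exact h6.comp (h4.comp ((h3 ▸ h2).comp h1))

theorem mode_torusChart {d : ℕ} {L : ℝ} (hL : 0 < L) (k : Fin d → ℤ) (y : UnitAddTorus (Fin d)) :
    mode L k (torusChart d L y) = mFourier k y := by
  simp only [mode, torusChart, mFourier, ContinuousMap.coe_mk, PiLp.smul_apply, smul_eq_mul]
  have : ∀ i, fourier (k i) (y i) =
      Complex.exp (2 * Real.pi * Complex.I * (k i) *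
        ((AddCircle.equivIoc 1 (-(1 / 2)) (y i) : ℝ) : ℂ) / ((1 : ℝ) : ℂ)) := by
    intro i
    rw [← fourier_coe_apply, AddCircle.coe_equivIoc]
  rw [Finset.prod_congr rfl (fun i _ => this i), ← Complex.exp_sum]
  congr 1
  push_cast
  rw [Finset.mul_sum, Finset.sum_div, Finset.mul_sum]
  refine Finset.sum_congr rfl fun i _ => ?_
  have : (L : ℂ) ≠ 0 := by exact_mod_cast hL.ne'
  field_simp

theorem measurableSet_window (d : ℕ) (L : ℝ) : MeasurableSet (window d L) := by
  have : window d L = ⋂ i, {x : E d | |x i| ≤ L} := by ext x; simp [window]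
  rw [this]
  exact MeasurableSet.iInter fun i => measurableSet_le (by fun_prop) (by fun_prop)

theorem continuous_mode {d : ℕ} (L : ℝ) (k : Fin d → ℤ) : Continuous (mode L k) := by
  unfold mode
  fun_prop

theorem continuous_fourierProj {d : ℕ} (L : ℝ) (N : ℕ) (g : E d → ℂ) :
    Continuous (fourierProj L N g) := by
  unfold fourierProj
  exact continuous_finsetSum _ fun k _ => continuous_const.mul (continuous_mode L k)

theorem integral_comp_torusChart {d : ℕ} {L : ℝ} (hL : 0 < L) {F : Type*} [NormedAddCommGroup F]
    [NormedSpace ℝ F] {g : E d → F} (hg : AEStronglyMeasurable g (volume.restrict (window d L))) :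
    ∫ y, g (torusChart d L y) = ((2 * L) ^ d)⁻¹ • ∫ x in window d L, g x := by
  have h := measurePreserving_torusChart d hL
  rw [← integral_map h.measurable.aemeasurable, h.map_eq, integral_smul_measure,
    ENNReal.toReal_ofReal (by positivity)]
  rw [h.map_eq]
  exact hg.smul_measure _

theorem mFourierCoeff_comp_torusChart {d : ℕ} {L : ℝ} (hL : 0 < L) {g : E d → ℂ}
    (hg : AEStronglyMeasurable g (volume.restrict (window d L))) (k : Fin d → ℤ) :
    mFourierCoeff (g ∘ torusChart d L) k = fourierCoeffWindow L g k := by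
  have h := integral_comp_torusChart hL (hg.mul (continuous_mode L (-k)).aestronglyMeasurable)
  simp only [Pi.mul_apply] at h
  rw [fourierCoeffWindow, ← h]
  simp only [mFourierCoeff, Function.comp_apply, mode_torusChart hL, smul_eq_mul,
    mul_comm]

/-- Parseval's identity on the window, for the remainder of a partial Fourier sum. -/
theorem hasSum_sq_fourierCoeffWindow_sub_sum {d : ℕ} {L : ℝ} (hL : 0 < L) {g : E d → ℂ}
    (hg : MemLp g 2 (volume.restrict (window d L))) (S : Finset (Fin d → ℤ)) :
    HasSum (fun k => if k ∈ S then 0 else ‖fourierCoeffWindow L g k‖ ^ 2)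
      (((2 * L) ^ d)⁻¹ * ∫ x in window d L,
        ‖g x - ∑ k ∈ S, fourierCoeffWindow L g k * mode L k x‖ ^ 2) := by
  have hc := mFourierCoeff_comp_torusChart hL hg.1
  have h := hasSum_sq_mFourierCoeff_sub_sum (g ∘ torusChart d L)
    ((hg.smul_measure ENNReal.ofReal_ne_top).comp_measurePreserving
      (measurePreserving_torusChart d hL)) S
  simp only [hc, ← mode_torusChart hL] at h
  rw [← smul_eq_mul, ← integral_comp_torusChart hL]
  · exact h
  · refine (AEStronglyMeasurable.norm ?_).pow 2
    refine hg.1.sub (Continuous.aestronglyMeasurable ?_)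
    exact continuous_finsetSum _ fun k _ => continuous_const.mul (continuous_mode L k)

end Parseval

/-! ### Schwartz functions: the product rule, Sobolev norms and density -/

section Schwartz

open SchwartzMap LineDeriv

theorem lineDerivOp_smulLeftCLM {d : ℕ} (v : E d) (χ φ : 𝓢(E d, ℂ)) :
    ∂_{v} (smulLeftCLM ℂ χ φ) = smulLeftCLM ℂ (∂_{v} χ : 𝓢(E d, ℂ)) φ + smulLeftCLM ℂ χ (∂_{v} φ) := by
  ext x
  have h : (smulLeftCLM ℂ χ φ : E d → ℂ) = fun x => χ x * φ x := by
    ext y; simp [smulLeftCLM_apply_apply χ.hasTemperateGrowth]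
  rw [lineDerivOp_apply_eq_fderiv, h, fderiv_fun_mul χ.differentiableAt φ.differentiableAt]
  simp [smulLeftCLM_apply_apply χ.hasTemperateGrowth,
    smulLeftCLM_apply_apply (∂_{v} χ : 𝓢(E d, ℂ)).hasTemperateGrowth, lineDerivOp_apply_eq_fderiv]
  ring

/-- A pointwise bound of `F` by `c |G|` gives the same bound of the `L²` norms. -/
theorem norm_toLp_le_of_norm_le {d : ℕ} {F G : 𝓢(E d, ℂ)} {c : ℝ}
    (h : ∀ x, ‖F x‖ ≤ c * ‖G x‖) : ‖F.toLp 2 volume‖ ≤ c * ‖G.toLp 2 volume‖ := by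
  refine Lp.norm_le_mul_norm_of_ae_le_mul ?_
  filter_upwards [F.coeFn_toLp 2 volume, G.coeFn_toLp 2 volume] with x hF hG
  rw [hF, hG]
  exact h x

/-- The iterated product rule in `L²`. By induction on the order, differentiating once costs a
factor `1 + M`, since `∂(χ φ) = (∂χ) φ + χ ∂φ` and the derivatives of `∂χ` obey the hypothesis with
`K M` in the place of `K`. -/
theorem norm_toLp_iterate_lineDerivOp_smul_le {d : ℕ} (v : E d) {M A : ℝ} (hM : 0 ≤ M)
    (n : ℕ) (χ φ : 𝓢(E d, ℂ)) {K : ℝ} (hK : 0 ≤ K)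
    (hχ : ∀ j ≤ n, ∀ x, ‖(∂_{v}^[j] χ : 𝓢(E d, ℂ)) x‖ ≤ K * M ^ j)
    (hφ : ∀ j ≤ n, ‖(∂_{v}^[j] φ : 𝓢(E d, ℂ)).toLp 2 volume‖ ≤ A) :
    ‖(∂_{v}^[n] (smulLeftCLM ℂ χ φ) : 𝓢(E d, ℂ)).toLp 2 volume‖ ≤ K * (1 + M) ^ n * A := by
  induction n generalizing χ φ K with
  | zero =>
    have h0 := hχ 0 le_rfl
    have h1 := hφ 0 le_rfl
    simp only [Function.iterate_zero, id_eq, pow_zero, mul_one] at h0 h1 ⊢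
    refine (norm_toLp_le_of_norm_le (c := K) (G := φ) fun x => ?_).trans
      (mul_le_mul_of_nonneg_left h1 hK)
    rw [smulLeftCLM_apply_apply χ.hasTemperateGrowth, norm_smul]
    exact mul_le_mul_of_nonneg_right (h0 x) (norm_nonneg _)
  | succ n ih =>
    have hadd : ∂_{v}^[n + 1] (smulLeftCLM ℂ χ φ) =
        ∂_{v}^[n] (smulLeftCLM ℂ (∂_{v} χ : 𝓢(E d, ℂ)) φ) + ∂_{v}^[n] (smulLeftCLM ℂ χ (∂_{v} φ)) := by
      rw [Function.iterate_succ_apply, lineDerivOp_smulLeftCLM]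
      simp only [← iteratedLineDerivOp_const_eq_iter_lineDerivOp, iteratedLineDerivOp_add]
    have h1 := ih (∂_{v} χ) φ (K := K * M) (by positivity)
      (fun j hj x => by
        have := hχ (j + 1) (by omega) x
        rw [Function.iterate_succ_apply] at this
        rw [mul_assoc, ← pow_succ']
        exact this)
      (fun j hj => hφ j (by omega))
    have h2 := ih χ (∂_{v} φ) hK (fun j hj => hχ j (by omega))
      (fun j hj => by
        have := hφ (j + 1) (by omega)
        rwa [Function.iterate_succ_apply] at this)
    have h3 : ((∂_{v}^[n + 1] (smulLeftCLM ℂ χ φ) : 𝓢(E d, ℂ)).toLp 2 volume) =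
        (∂_{v}^[n] (smulLeftCLM ℂ (∂_{v} χ : 𝓢(E d, ℂ)) φ) : 𝓢(E d, ℂ)).toLp 2 volume +
        (∂_{v}^[n] (smulLeftCLM ℂ χ (∂_{v} φ)) : 𝓢(E d, ℂ)).toLp 2 volume := by
      rw [hadd]
      exact map_add (toLpCLM ℂ ℂ 2 (volume : Measure (E d))) _ _
    rw [h3]
    refine (norm_add_le _ _).trans ((add_le_add h1 h2).trans_eq ?_)
    ring

theorem fourier_iterate_lineDerivOp {d : ℕ} (v : E d) (n : ℕ) (φ : 𝓢(E d, ℂ)) (ξ : E d) :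
    (𝓕 (∂_{v}^[n] φ : 𝓢(E d, ℂ))) ξ =
      (2 * Real.pi * Complex.I * (inner ℝ ξ v : ℝ)) ^ n * (𝓕 φ) ξ := by
  induction n with
  | zero => simp
  | succ n ih =>
    have hg : (inner ℝ · v : E d → ℝ).HasTemperateGrowth := by fun_prop
    rw [Function.iterate_succ_apply', fourier_lineDerivOp_eq, smul_apply,
      smulLeftCLM_apply_apply hg, ih, Complex.real_smul, smul_eq_mul]
    ring

theorem one_le_besselSymbol {d : ℕ} {s : ℝ} (hs : 0 ≤ s) (ξ : E d) : 1 ≤ besselSymbol s ξ :=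
  Real.one_le_rpow (by nlinarith [sq_nonneg (2 * Real.pi * ‖ξ‖)]) (by positivity)

theorem pow_le_besselSymbol {d : ℕ} {j γ : ℕ} (hj : j ≤ γ) (ξ : E d) :
    (2 * Real.pi * ‖ξ‖) ^ j ≤ besselSymbol γ ξ := by
  set t := 2 * Real.pi * ‖ξ‖ with ht
  have ht0 : 0 ≤ t := by positivity
  have h1 : t ≤ √(1 + t ^ 2) := Real.le_sqrt_of_sq_le (by linarith)
  have h2 : 1 ≤ √(1 + t ^ 2) := Real.one_le_sqrt.mpr (by nlinarith [sq_nonneg t])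
  have h3 : besselSymbol γ ξ = √(1 + t ^ 2) ^ γ := by
    rw [besselSymbol, ← ht, Real.sqrt_eq_rpow, ← Real.rpow_mul_natCast (by positivity)]
    congr 1
    ring
  rw [h3]
  exact (pow_le_pow_left₀ ht0 h1 j).trans (pow_le_pow_right₀ h2 hj)

/-- Plancherel's theorem bounds the `L²` norm of a directional derivative by the Sobolev norm. -/
theorem norm_toLp_iterate_lineDerivOp_le {d γ : ℕ} {φ h : 𝓢(E d, ℂ)}
    (hh : ∀ ξ, h ξ = besselSymbol (γ : ℝ) ξ • (𝓕 φ) ξ) {v : E d} (hv : ‖v‖ ≤ 1) {j : ℕ}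
    (hj : j ≤ γ) :
    ‖(∂_{v}^[j] φ : 𝓢(E d, ℂ)).toLp 2 volume‖ ≤ ‖h.toLp 2 volume‖ := by
  rw [← norm_fourier_toL2_eq, ← one_mul ‖h.toLp 2 volume‖]
  refine norm_toLp_le_of_norm_le fun ξ => ?_
  have hpos : 0 ≤ besselSymbol (γ : ℝ) ξ := zero_le_one.trans (one_le_besselSymbol (by positivity) ξ)
  rw [fourier_iterate_lineDerivOp, hh, norm_mul, norm_smul, one_mul, norm_pow,
    Real.norm_of_nonneg hpos]
  refine mul_le_mul_of_nonneg_right (le_trans ?_ (pow_le_besselSymbol hj ξ)) (norm_nonneg _)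
  refine pow_le_pow_left₀ (norm_nonneg _) ?_ j
  have h1 : ‖(inner ℝ ξ v : ℝ)‖ ≤ ‖ξ‖ :=
    (norm_inner_le_norm ξ v).trans (mul_le_of_le_one_right (norm_nonneg _) hv)
  simp only [norm_mul, Complex.norm_I, Complex.norm_real, Complex.norm_ofNat, mul_one,
    Real.norm_of_nonneg Real.pi_pos.le]
  exact mul_le_mul_of_nonneg_left h1 (by positivity)

theorem sobolevNorm_eq {d : ℕ} (s : ℝ) (f : L2 d) (hf : MemH s f) :
    sobolevNorm s f hf = ‖MemLp.toLp _ hf‖ := by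
  rw [sobolevNorm, besselPotential, ← Lp.norm_fourier_eq, FourierTransform.fourier_fourierInv_eq]

theorem hasTemperateGrowth_besselSymbol_neg {d : ℕ} (s : ℝ) :
    (fun ξ : E d => besselSymbol (-s) ξ).HasTemperateGrowth := by
  have h := (Function.hasTemperateGrowth_one_add_norm_sq_rpow (H := E d) (-s / 2)).comp
    ((2 * Real.pi) • ContinuousLinearMap.id ℝ (E d)).hasTemperateGrowth
  have heq : (fun ξ : E d => besselSymbol (-s) ξ) = (fun x => (1 + ‖x‖ ^ 2) ^ (-s / 2)) ∘
      ((2 * Real.pi) • ContinuousLinearMap.id ℝ (E d)) := by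
    ext ξ
    simp [besselSymbol, norm_smul, abs_of_pos Real.pi_pos]
  rw [heq]
  exact h

/-- Schwartz functions are dense in the Sobolev space: `φ` is the Schwartz function with
`(1 + |2πξ|²)^{s/2} 𝓕 φ = h`, for a Schwartz function `h` close to `(1 + |2πξ|²)^{s/2} 𝓕 f`
in `L²`. -/
theorem exists_schwartz_approx {d : ℕ} {s : ℝ} (hs : 0 ≤ s) (f : L2 d) (hf : MemH s f) {ε : ℝ}
    (hε : 0 < ε) :
    ∃ φ h : 𝓢(E d, ℂ), (∀ ξ, h ξ = besselSymbol s ξ • (𝓕 φ) ξ) ∧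
      ‖h.toLp 2 volume‖ ≤ sobolevNorm s f hf + ε ∧ ‖f - φ.toLp 2 volume‖ ≤ ε := by
  obtain ⟨_, hh, ⟨h, rfl⟩⟩ := Metric.dense_iff.mp
    (denseRange_toLpCLM (E := E d) (F := ℂ) (μ := volume) (p := 2) ENNReal.ofNat_ne_top)
    (MemLp.toLp _ hf) ε hε
  rw [Metric.mem_ball, dist_comm, dist_eq_norm, toLpCLM_apply] at hh
  have hφ : 𝓕 (𝓕⁻ (smulLeftCLM ℂ (fun ξ : E d => besselSymbol (-s) ξ) h)) =
      smulLeftCLM ℂ (fun ξ : E d => besselSymbol (-s) ξ) h :=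
    FourierTransform.fourier_fourierInv_eq _
  have hpos (ξ : E d) : 0 < 1 + (2 * Real.pi * ‖ξ‖) ^ 2 := by positivity
  refine ⟨𝓕⁻ (smulLeftCLM ℂ (fun ξ : E d => besselSymbol (-s) ξ) h), h, fun ξ => ?_, ?_, ?_⟩
  · rw [hφ, smulLeftCLM_apply_apply (hasTemperateGrowth_besselSymbol_neg s), smul_smul,
      besselSymbol, besselSymbol, ← Real.rpow_add (hpos ξ)]
    simp [neg_div]
  · rw [sobolevNorm_eq]
    have := norm_sub_norm_le (h.toLp 2 volume) (MemLp.toLp _ hf)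
    rw [norm_sub_rev] at this
    linarith
  · refine le_trans ?_ hh.le
    rw [← Lp.norm_fourier_eq, sub_eq_add_neg, FourierTransform.fourier_add,
      FourierTransform.fourier_neg, ← sub_eq_add_neg, toLp_fourier_eq, hφ]
    refine Lp.norm_le_norm_of_ae_le ?_
    filter_upwards [Lp.coeFn_sub (𝓕 f : L2 d)
        ((smulLeftCLM ℂ (fun ξ : E d => besselSymbol (-s) ξ) h).toLp 2 volume),
      Lp.coeFn_sub (MemLp.toLp _ hf) (h.toLp 2 volume), hf.coeFn_toLp,
      h.coeFn_toLp 2 volume,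
      (smulLeftCLM ℂ (fun ξ : E d => besselSymbol (-s) ξ) h).coeFn_toLp 2 volume]
      with ξ h1 h2 h3 h4 h5
    rw [h1, h2, Pi.sub_apply, Pi.sub_apply, h3, h4, h5,
      smulLeftCLM_apply_apply (hasTemperateGrowth_besselSymbol_neg s)]
    have hb : h ξ = besselSymbol s ξ • besselSymbol (-s) ξ • h ξ := by
      rw [smul_smul, besselSymbol, besselSymbol, ← Real.rpow_add (hpos ξ)]
      simp [neg_div]
    conv_rhs => rw [hb]
    rw [← smul_sub, norm_smul, Real.norm_of_nonneg (zero_le_one.trans (one_le_besselSymbol hs ξ))]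
    exact le_mul_of_one_le_left (norm_nonneg _) (one_le_besselSymbol hs ξ)

end Schwartz

/-! ### The remainder of the Fourier projection -/

section Remainder

open SchwartzMap LineDeriv

theorem isCompact_window (d : ℕ) (L : ℝ) : IsCompact (window d L) := by
  refine Metric.isCompact_of_isClosed_isBounded ?_ ?_
  · have : window d L = ⋂ i, {x : E d | |x i| ≤ L} := by ext x; simp [window]
    rw [this]
    exact isClosed_iInter fun i => isClosed_le (by fun_prop) continuous_const
  · refine (Metric.isBounded_closedBall (x := (0 : E d)) (r := √(d * L ^ 2))).subset fun x hx => ?_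
    rw [mem_closedBall_zero_iff, EuclideanSpace.norm_eq]
    refine Real.sqrt_le_sqrt ?_
    calc ∑ i, ‖x i‖ ^ 2 ≤ ∑ _i : Fin d, L ^ 2 :=
          Finset.sum_le_sum fun i _ => pow_le_pow_left₀ (norm_nonneg _) (hx i) 2
      _ = d * L ^ 2 := by simp

instance isFiniteMeasure_restrict_window (d : ℕ) (L : ℝ) :
    IsFiniteMeasure ((volume : Measure (E d)).restrict (window d L)) :=
  isFiniteMeasure_restrict.mpr (isCompact_window d L).measure_lt_top.ne

theorem eLpNorm_two_le_ofReal {α : Type*} [MeasurableSpace α] {μ : Measure α} {f : α → ℂ}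
    (hf : MemLp f 2 μ) {c : ℝ} (hc : 0 ≤ c) (h : ∫ x, ‖f x‖ ^ 2 ∂μ ≤ c ^ 2) :
    eLpNorm f 2 μ ≤ ENNReal.ofReal c := by
  rw [hf.eLpNorm_eq_integral_rpow_norm two_ne_zero ENNReal.ofNat_ne_top]
  refine ENNReal.ofReal_le_ofReal ?_
  simp only [ENNReal.toReal_ofNat, Real.rpow_ofNat]
  rw [← one_div, ← Real.sqrt_eq_rpow]
  exact Real.sqrt_le_iff.mpr ⟨hc, h⟩

theorem integral_norm_sq_eq {α : Type*} [MeasurableSpace α] {μ : Measure α} {f : α → ℂ}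
    (hf : MemLp f 2 μ) : ∫ x, ‖f x‖ ^ 2 ∂μ = (eLpNorm f 2 μ).toReal ^ 2 := by
  rw [hf.eLpNorm_eq_integral_rpow_norm two_ne_zero ENNReal.ofNat_ne_top]
  simp only [ENNReal.toReal_ofNat, Real.rpow_ofNat]
  rw [← one_div, ← Real.sqrt_eq_rpow, ENNReal.toReal_ofReal (Real.sqrt_nonneg _),
    Real.sq_sqrt (integral_nonneg fun x => by positivity)]

theorem memLp_fourierProj {d : ℕ} (L : ℝ) (N : ℕ) (g : E d → ℂ) :
    MemLp (fourierProj L N g) 2 (volume.restrict (window d L)) := by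
  have hc := continuous_fourierProj L N g
  obtain ⟨B, hB⟩ := (isCompact_window d L).exists_bound_of_continuousOn hc.continuousOn
  refine MemLp.of_bound hc.aestronglyMeasurable B ?_
  exact ae_restrict_of_forall_mem (measurableSet_window d L) hB

/-- The remainder of the Fourier projection is a contraction of `L²` of the window. -/
theorem eLpNorm_sub_fourierProj_le {d : ℕ} {L : ℝ} (hL : 0 < L) (N : ℕ) {g : E d → ℂ}
    (hg : MemLp g 2 (volume.restrict (window d L))) :
    eLpNorm (fun x => g x - fourierProj L N g x) 2 (volume.restrict (window d L)) ≤
      eLpNorm g 2 (volume.restrict (window d L)) := by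
  rw [← ENNReal.ofReal_toReal hg.2.ne]
  refine eLpNorm_two_le_ofReal (hg.sub (memLp_fourierProj L N g)) ENNReal.toReal_nonneg ?_
  rw [← integral_norm_sq_eq hg]
  have h1 := hasSum_sq_fourierCoeffWindow_sub_sum hL hg
    (Finset.Icc (fun _ : Fin d => -(N : ℤ)) (fun _ => (N : ℤ)))
  have h2 := hasSum_sq_fourierCoeffWindow_sub_sum hL hg ∅
  have h3 := hasSum_le (fun k => by
    simp only [Finset.notMem_empty, if_false]
    split_ifs
    · positivity
    · exact le_rfl) h1 h2
  simp only [Finset.sum_empty, sub_zero] at h3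
  exact le_of_mul_le_mul_left h3 (by positivity)

theorem fourierProj_add {d : ℕ} (L : ℝ) (N : ℕ) {g₁ g₂ : E d → ℂ}
    (h₁ : MemLp g₁ 2 (volume.restrict (window d L)))
    (h₂ : MemLp g₂ 2 (volume.restrict (window d L))) (x : E d) :
    fourierProj L N (fun x => g₁ x + g₂ x) x = fourierProj L N g₁ x + fourierProj L N g₂ x := by
  have hint {g : E d → ℂ} (hg : MemLp g 2 (volume.restrict (window d L))) (k : Fin d → ℤ) :
      Integrable (fun x => g x * mode L k x) (volume.restrict (window d L)) := by
    refine (hg.integrable one_le_two).mul_bdd (c := 1)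
      (continuous_mode L k).aestronglyMeasurable (Filter.Eventually.of_forall fun x => ?_)
    rw [mode, mul_comm, Complex.norm_exp_ofReal_mul_I]
  simp only [fourierProj, fourierCoeffWindow, add_mul]
  rw [← Finset.sum_add_distrib]
  refine Finset.sum_congr rfl fun k _ => ?_
  rw [integral_add (hint h₁ _) (hint h₂ _), smul_add, add_mul]

/-- The Fourier coefficients of a Schwartz function supported in the window sample its Fourier
transform. -/
theorem fourierCoeffWindow_eq_fourier {d : ℕ} {L : ℝ} (hL : 0 < L) (g : 𝓢(E d, ℂ))
    (hg : tsupport g ⊆ window d L) (k : Fin d → ℤ) :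
    fourierCoeffWindow L g k =
      (((2 * L) ^ d)⁻¹ : ℝ) • (𝓕 g) (WithLp.toLp 2 fun i => (k i : ℝ) / (2 * L)) := by
  rw [fourierCoeffWindow, fourier_coe, Real.fourier_eq,
    setIntegral_eq_integral_of_forall_compl_eq_zero]
  · congr 1
    refine integral_congr_ae (Filter.Eventually.of_forall fun x => ?_)
    simp only [mode, Circle.smul_def, Real.fourierChar_apply, smul_eq_mul]
    rw [mul_comm]
    congr 2
    rw [mul_comm Complex.I]
    congr 2
    simp only [PiLp.inner_apply, RCLike.inner_apply, conj_trivial, Pi.neg_apply]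
    rw [Finset.mul_sum, ← Finset.sum_neg_distrib, Finset.mul_sum, Finset.sum_div]
    refine Finset.sum_congr rfl fun i _ => ?_
    push_cast
    field_simp
  · intro x hx
    rw [image_eq_zero_of_notMem_tsupport fun h => hx (hg h), zero_mul]

theorem norm_fourierCoeffWindow_iterate_lineDerivOp {d : ℕ} {L : ℝ} (hL : 0 < L)
    (g : 𝓢(E d, ℂ)) (hg : tsupport g ⊆ window d L) (n : ℕ) (i : Fin d) (k : Fin d → ℤ) :
    ‖fourierCoeffWindow L (∂_{EuclideanSpace.single i (1 : ℝ)}^[n] g : 𝓢(E d, ℂ)) k‖ =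
      (Real.pi * |(k i : ℝ)| / L) ^ n * ‖fourierCoeffWindow L g k‖ := by
  have hsupp : tsupport (∂_{EuclideanSpace.single i (1 : ℝ)}^[n] g : 𝓢(E d, ℂ)) ⊆ window d L := by
    rw [← iteratedLineDerivOp_const_eq_iter_lineDerivOp]
    exact (tsupport_iteratedLineDerivOp_subset _ g).trans hg
  rw [fourierCoeffWindow_eq_fourier hL _ hsupp, fourierCoeffWindow_eq_fourier hL g hg,
    fourier_iterate_lineDerivOp, norm_smul, norm_smul, norm_mul, norm_pow]
  have : ‖2 * (Real.pi : ℂ) * Complex.I * (inner ℝ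
      (WithLp.toLp 2 fun i => (k i : ℝ) / (2 * L) : E d)
      (EuclideanSpace.single i (1 : ℝ)) : ℝ)‖ = Real.pi * |(k i : ℝ)| / L := by
    simp only [EuclideanSpace.inner_single_right, one_mul, conj_trivial, norm_mul,
      Complex.norm_I, Complex.norm_real, Complex.norm_ofNat, mul_one,
      Real.norm_of_nonneg Real.pi_pos.le, Real.norm_eq_abs, abs_div, abs_mul, abs_of_pos hL, abs_two]
    field_simp
  rw [this]
  ring

/-- The spectral estimate. A frequency `k` with `|k|_∞ > N` has a coordinate `|k i| > N`, so that
only the pure derivatives `∂_i^n g` enter. -/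
theorem eLpNorm_schwartz_sub_fourierProj_le {d : ℕ} {L : ℝ} (hL : 0 < L) {N : ℕ} (hN : 1 ≤ N)
    (n : ℕ) (g : 𝓢(E d, ℂ)) (hg : tsupport g ⊆ window d L) {B : ℝ} (hB0 : 0 ≤ B)
    (hB : ∀ i : Fin d,
      ‖(∂_{EuclideanSpace.single i (1 : ℝ)}^[n] g : 𝓢(E d, ℂ)).toLp 2 volume‖ ≤ B) :
    eLpNorm (fun x => g x - fourierProj L N g x) 2 (volume.restrict (window d L)) ≤
      ENNReal.ofReal (d * ((N : ℝ) * L⁻¹) ^ (-(n : ℤ)) * B) := by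
  set q := ((N : ℝ) * L⁻¹) ^ (-(n : ℤ)) with hq
  have hN0 : (0 : ℝ) < N := by exact_mod_cast hN
  have hq0 : 0 < q := by positivity
  have hmem (G : 𝓢(E d, ℂ)) : MemLp G 2 (volume.restrict (window d L)) :=
    (G.memLp 2 volume).restrict _
  refine eLpNorm_two_le_ofReal ((hmem g).sub (memLp_fourierProj L N g)) (by positivity) ?_
  set D : Fin d → 𝓢(E d, ℂ) := fun i => ∂_{EuclideanSpace.single i (1 : ℝ)}^[n] g with hD
  have h1 := hasSum_sq_fourierCoeffWindow_sub_sum hL (hmem g)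
    (Finset.Icc (fun _ : Fin d => -(N : ℤ)) (fun _ => (N : ℤ)))
  have h2 (i : Fin d) : HasSum (fun k => ‖fourierCoeffWindow L (D i) k‖ ^ 2)
      (((2 * L) ^ d)⁻¹ * ∫ x in window d L, ‖D i x‖ ^ 2) := by
    simpa using hasSum_sq_fourierCoeffWindow_sub_sum hL (hmem (D i)) ∅
  have h3 := (hasSum_sum (fun i (_ : i ∈ Finset.univ) => h2 i)).mul_left (q ^ 2)
  have h4 := hasSum_le (fun k => by
    split_ifs with hk
    · positivity
    · obtain ⟨i, hi⟩ : ∃ i, (N : ℝ) < |(k i : ℝ)| := by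
        by_contra! hcon
        refine hk (Finset.mem_Icc.mpr ⟨fun i => ?_, fun i => ?_⟩)
        · have := (abs_le.mp (hcon i)).1
          exact_mod_cast this
        · have := (abs_le.mp (hcon i)).2
          exact_mod_cast this
      have hle : ‖fourierCoeffWindow L g k‖ ≤ q * ‖fourierCoeffWindow L (D i) k‖ := by
        rw [hD, norm_fourierCoeffWindow_iterate_lineDerivOp hL g hg, ← mul_assoc]
        refine le_mul_of_one_le_left (norm_nonneg _) ?_
        rw [hq, zpow_neg, zpow_natCast, ← inv_pow, ← mul_pow]
        refine one_le_pow₀ ?_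
        rw [mul_inv, inv_inv]
        have hpi : (1 : ℝ) ≤ Real.pi := by linarith [Real.pi_gt_three]
        have : (N : ℝ) ≤ Real.pi * |(k i : ℝ)| := by nlinarith [abs_nonneg (k i : ℝ)]
        rw [show (N : ℝ)⁻¹ * L * (Real.pi * |(k i : ℝ)| / L) = (Real.pi * |(k i : ℝ)|) / N by
          field_simp]
        exact (one_le_div hN0).mpr this
      calc ‖fourierCoeffWindow L g k‖ ^ 2 ≤ (q * ‖fourierCoeffWindow L (D i) k‖) ^ 2 :=
            pow_le_pow_left₀ (norm_nonneg _) hle 2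
        _ = q ^ 2 * ‖fourierCoeffWindow L (D i) k‖ ^ 2 := by ring
        _ ≤ q ^ 2 * ∑ i, ‖fourierCoeffWindow L (D i) k‖ ^ 2 :=
            mul_le_mul_of_nonneg_left (Finset.single_le_sum
              (f := fun i => ‖fourierCoeffWindow L (D i) k‖ ^ 2) (fun _ _ => by positivity)
              (Finset.mem_univ i)) (by positivity)) h1 h3
  rw [← Finset.mul_sum, mul_left_comm] at h4
  have h5 := le_of_mul_le_mul_left h4 (by positivity)
  refine h5.trans ?_
  have h6 (i : Fin d) : ∫ x in window d L, ‖D i x‖ ^ 2 ≤ B ^ 2 := by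
    rw [integral_norm_sq_eq (hmem (D i))]
    refine pow_le_pow_left₀ ENNReal.toReal_nonneg (le_trans ?_ (hB i)) 2
    rw [SchwartzMap.norm_toLp]
    exact ENNReal.toReal_mono ((D i).memLp 2 volume).2.ne
      (eLpNorm_mono_measure _ Measure.restrict_le_self)
  calc q ^ 2 * ∑ i, ∫ x in window d L, ‖D i x‖ ^ 2 ≤ q ^ 2 * ∑ _i : Fin d, B ^ 2 := by
        gcongr with i
        exact h6 i
    _ = d * (q * B) ^ 2 := by
        rw [Finset.sum_const, Finset.card_univ, Fintype.card_fin, nsmul_eq_mul]; ring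
    _ ≤ (d : ℝ) ^ 2 * (q * B) ^ 2 := by
        gcongr
        exact_mod_cast Nat.le_self_pow two_ne_zero d
    _ = (d * q * B) ^ 2 := by ring

end Remainder

/-! ### Cut-offs with uniform layer constants -/

section Cutoffs

/-- A smooth function of compact support has a layer constant for any fixed `a`. -/
theorem IsCutoff.exists_layerBound {d : ℕ} {a : ℝ} (ha : 0 < a) (ha1 : a < 1) {χ : E d → ℝ}
    (hχ : IsCutoff a χ) (m : ℕ) : ∃ K : ℝ, LayerBound m K a χ := by
  have hb (j : ℕ) : ∃ B : ℝ, ∀ x, ‖iteratedFDeriv ℝ j χ x‖ ≤ B :=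
    ((hχ.smooth.of_le (mod_cast le_top)).continuous_iteratedFDeriv
      le_rfl).bounded_above_of_compact_support (hχ.hasCompactSupport.iteratedFDeriv j)
  choose B hB using hb
  refine ⟨∑ j ∈ Finset.range (m + 1), |B j|, fun j hj x => ?_⟩
  have h1 : B j ≤ ∑ j ∈ Finset.range (m + 1), |B j| :=
    (le_abs_self _).trans (Finset.single_le_sum (f := fun j => |B j|) (fun _ _ => abs_nonneg _)
      (Finset.mem_range.mpr (by omega)))
  refine ((hB j x).trans h1).trans (le_mul_of_one_le_right
    (Finset.sum_nonneg fun _ _ => abs_nonneg _) ?_)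
  rw [zpow_neg, zpow_natCast]
  exact (one_le_inv₀ (by have : 0 < 1 - a := by linarith
                         positivity)).mpr (pow_le_one₀ (by linarith) (by linarith))

/-- All derivatives of the smooth transition function are bounded: those of positive order vanish
off `[0, 1]`. -/
theorem exists_bound_iteratedFDeriv_smoothTransition (j : ℕ) :
    ∃ B : ℝ, ∀ t, ‖iteratedFDeriv ℝ j Real.smoothTransition t‖ ≤ B := by
  rcases Nat.eq_zero_or_pos j with rfl | hj
  · refine ⟨1, fun t => ?_⟩
    rw [norm_iteratedFDeriv_zero, Real.norm_of_nonneg (Real.smoothTransition.nonneg t)]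
    exact Real.smoothTransition.le_one t
  · refine ((Real.smoothTransition.contDiff (n := (j : ℕ∞))).continuous_iteratedFDeriv
      le_rfl).bounded_above_of_compact_support ?_
    refine HasCompactSupport.intro (isCompact_Icc (a := (0 : ℝ)) (b := 1)) fun t ht => ?_
    rw [Set.mem_Icc, not_and_or, not_le, not_le] at ht
    have hconst : ∃ c : ℝ, Real.smoothTransition =ᶠ[nhds t] fun _ => c := by
      rcases ht with ht | ht
      · exact ⟨0, by filter_upwards [Iio_mem_nhds ht] with s hs
                     exact Real.smoothTransition.zero_of_nonpos (le_of_lt hs)⟩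
      · exact ⟨1, by filter_upwards [Ioi_mem_nhds ht] with s hs
                     exact Real.smoothTransition.one_of_one_le (le_of_lt hs)⟩
    obtain ⟨c, hc⟩ := hconst
    rw [(hc.iteratedFDeriv ℝ j).eq_of_nhds, iteratedFDeriv_const_of_ne hj.ne']
    rfl

/-- The profile `τ(s) = σ(2 (1 + s) / (1 - a) - 1)` of the transition at the face `s = -1`: it
vanishes for `s ≤ -(1 + a) / 2` and equals `1` for `s ≥ -a`. -/
def faceProfile (a s : ℝ) : ℝ := Real.smoothTransition (2 * (1 + s) / (1 - a) - 1)

/-- The family of cut-offs: the product over all faces of the cube of their profiles. -/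
def cubeCutoff (d : ℕ) (a : ℝ) (x : E d) : ℝ :=
  ∏ i, faceProfile a (x i) * faceProfile a (-x i)

/-- A family of smooth functions with layer constants, to all orders, that are uniform in `a`. -/
def UniformLayerBound {d : ℕ} (u : ℝ → E d → ℝ) : Prop :=
  (∀ a, ContDiff ℝ (⊤ : ℕ∞) (u a)) ∧
    ∀ m : ℕ, ∃ K : ℝ, ∀ a : ℝ, 0 < a → a < 1 → LayerBound m K a (u a)

theorem UniformLayerBound.mul {d : ℕ} {u w : ℝ → E d → ℝ} (hu : UniformLayerBound u)
    (hw : UniformLayerBound w) : UniformLayerBound fun a x => u a x * w a x := by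
  refine ⟨fun a => (hu.1 a).mul (hw.1 a), fun m => ?_⟩
  obtain ⟨K, hK⟩ := hu.2 m
  obtain ⟨K', hK'⟩ := hw.2 m
  refine ⟨2 ^ m * (|K| * |K'|), fun a ha ha1 j hj x => ?_⟩
  have ha' : 0 < 1 - a := by linarith
  refine (norm_iteratedFDeriv_mul_le (hu.1 a) (hw.1 a) x (n := j) (mod_cast le_top)).trans ?_
  have hterm : ∀ i ∈ Finset.range (j + 1),
      (j.choose i : ℝ) * ‖iteratedFDeriv ℝ i (u a) x‖ * ‖iteratedFDeriv ℝ (j - i) (w a) x‖ ≤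
        (j.choose i : ℝ) * (|K| * |K'| * (1 - a) ^ (-(j : ℤ))) := by
    intro i hi
    have hij : i ≤ j := Nat.lt_succ_iff.mp (Finset.mem_range.mp hi)
    have h1 : ‖iteratedFDeriv ℝ i (u a) x‖ ≤ |K| * (1 - a) ^ (-(i : ℤ)) :=
      (hK a ha ha1 i (hij.trans hj) x).trans
        (mul_le_mul_of_nonneg_right (le_abs_self K) (by positivity))
    have h2 : ‖iteratedFDeriv ℝ (j - i) (w a) x‖ ≤ |K'| * (1 - a) ^ (-((j - i : ℕ) : ℤ)) :=
      (hK' a ha ha1 (j - i) (by omega) x).trans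
        (mul_le_mul_of_nonneg_right (le_abs_self K') (by positivity))
    rw [mul_assoc]
    refine mul_le_mul_of_nonneg_left ?_ (by positivity)
    refine (mul_le_mul h1 h2 (norm_nonneg _) (by positivity)).trans_eq ?_
    have : (1 - a) ^ (-(j : ℤ)) = (1 - a) ^ (-(i : ℤ)) * (1 - a) ^ (-((j - i : ℕ) : ℤ)) := by
      rw [← zpow_add₀ ha'.ne']
      congr 1
      omega
    rw [this]
    ring
  refine (Finset.sum_le_sum hterm).trans ?_
  rw [← Finset.sum_mul, ← Nat.cast_sum, Nat.sum_range_choose, Nat.cast_pow, Nat.cast_ofNat,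
    ← mul_assoc]
  gcongr
  exact one_le_two

theorem UniformLayerBound.one {d : ℕ} : UniformLayerBound fun (_ : ℝ) (_ : E d) => (1 : ℝ) := by
  refine ⟨fun a => contDiff_const, fun m => ⟨1, fun a ha ha1 j _ x => ?_⟩⟩
  have ha' : 0 < 1 - a := by linarith
  rcases Nat.eq_zero_or_pos j with rfl | hj
  · simp
  · rw [iteratedFDeriv_const_of_ne hj.ne', Pi.zero_apply, norm_zero]
    positivity

theorem UniformLayerBound.prod {d : ℕ} {ι : Type*} (s : Finset ι) {u : ι → ℝ → E d → ℝ}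
    (hu : ∀ i, UniformLayerBound (u i)) : UniformLayerBound fun a x => ∏ i ∈ s, u i a x := by
  classical
  induction s using Finset.induction_on with
  | empty => simpa using UniformLayerBound.one
  | insert i s hi ih => simpa [Finset.prod_insert hi] using (hu i).mul ih

theorem uniformLayerBound_faceProfile {d : ℕ} (ℓ : E d →L[ℝ] ℝ) (hℓ : ‖ℓ‖ ≤ 1) :
    UniformLayerBound fun a x => faceProfile a (ℓ x) := by
  have hσ (c : ℝ) : ContDiff ℝ (⊤ : ℕ∞) fun t : ℝ => Real.smoothTransition (t + c) :=
    (Real.smoothTransition.contDiff (n := ⊤)).comp (contDiff_id.add contDiff_const)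
  have heq (a : ℝ) : (fun x => faceProfile a (ℓ x)) =
      (fun t : ℝ => Real.smoothTransition (t + (2 / (1 - a) - 1))) ∘ ((2 / (1 - a)) • ℓ) := by
    ext x
    simp only [faceProfile, Function.comp_apply, FunLike.coe_smul,
      Pi.smul_apply, smul_eq_mul]
    congr 1
    ring
  refine ⟨fun a => ?_, fun m => ?_⟩
  · simp only [heq]
    exact (hσ _).comp (ContinuousLinearMap.contDiff _)
  choose B hB using exists_bound_iteratedFDeriv_smoothTransition
  refine ⟨2 ^ m * ∑ j ∈ Finset.range (m + 1), |B j|, fun a ha ha1 j hj x => ?_⟩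
  have ha' : 0 < 1 - a := by linarith
  simp only [heq]
  rw [ContinuousLinearMap.iteratedFDeriv_comp_right _ (hσ _) x (i := j) (mod_cast le_top)]
  refine (ContinuousMultilinearMap.norm_compContinuousLinearMap_le _ _).trans ?_
  rw [Finset.prod_const, Finset.card_univ, Fintype.card_fin, iteratedFDeriv_comp_add_right]
  have h1 : ‖(2 / (1 - a)) • ℓ‖ ≤ 2 * (1 - a)⁻¹ := by
    rw [norm_smul, Real.norm_of_nonneg (by positivity), div_eq_mul_inv]
    exact mul_le_of_le_one_right (by positivity) hℓ
  have h2 : B j ≤ ∑ j ∈ Finset.range (m + 1), |B j| :=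
    (le_abs_self _).trans (Finset.single_le_sum (f := fun j => |B j|) (fun _ _ => abs_nonneg _)
      (Finset.mem_range.mpr (by omega)))
  have h3 : 0 ≤ ∑ j ∈ Finset.range (m + 1), |B j| := Finset.sum_nonneg fun _ _ => abs_nonneg _
  refine (mul_le_mul ((hB j _).trans h2) (pow_le_pow_left₀ (norm_nonneg _) h1 j) (by positivity)
    h3).trans ?_
  rw [mul_pow, zpow_neg, zpow_natCast, inv_pow, ← mul_assoc, mul_comm _ ((2 : ℝ) ^ j)]
  gcongr
  exact one_le_two

theorem uniformLayerBound_cubeCutoff (d : ℕ) : UniformLayerBound (cubeCutoff d) := by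
  have hn (i : Fin d) : ‖(EuclideanSpace.proj i : E d →L[ℝ] ℝ)‖ ≤ 1 :=
    ContinuousLinearMap.opNorm_le_bound _ zero_le_one fun x => by
      rw [one_mul]; exact PiLp.norm_apply_le x i
  refine UniformLayerBound.prod Finset.univ (u := fun i a x =>
    faceProfile a (x i) * faceProfile a (-x i)) fun i => ?_
  refine UniformLayerBound.mul (uniformLayerBound_faceProfile (EuclideanSpace.proj i) (hn i)) ?_
  exact uniformLayerBound_faceProfile (-EuclideanSpace.proj i) (by rw [norm_neg]; exact hn i)

theorem isCutoff_cubeCutoff (d : ℕ) {a : ℝ} (ha1 : a < 1) :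
    IsCutoff a (cubeCutoff d a) := by
  have ha' : 0 < 1 - a := by linarith
  have hzero {s : ℝ} (hs : s ≤ -(1 + a) / 2) : faceProfile a s = 0 := by
    refine Real.smoothTransition.zero_of_nonpos ?_
    rw [sub_nonpos, div_le_one ha']
    linarith
  have hone {s : ℝ} (hs : -a ≤ s) : faceProfile a s = 1 := by
    refine Real.smoothTransition.one_of_one_le ?_
    rw [le_sub_iff_add_le, le_div_iff₀ ha']
    linarith
  have hsupp : Function.support (cubeCutoff d a) ⊆ window d ((1 + a) / 2) := by
    intro x hx i
    rw [Function.mem_support, cubeCutoff, Finset.prod_ne_zero_iff] at hx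
    have hi := mul_ne_zero_iff.mp (hx i (Finset.mem_univ i))
    rw [abs_le]
    constructor
    · by_contra! h
      exact hi.1 (hzero (by linarith))
    · by_contra! h
      exact hi.2 (hzero (by linarith))
  have htsupp : tsupport (cubeCutoff d a) ⊆ window d ((1 + a) / 2) :=
    closure_minimal hsupp (isCompact_window d _).isClosed
  refine ⟨(uniformLayerBound_cubeCutoff d).1 a, ?_, fun x hx => ?_, htsupp.trans fun x hx i => ?_⟩
  · exact (isCompact_window d _).of_isClosed_subset (isClosed_tsupport _) htsupp
  · refine Finset.prod_eq_one fun i _ => ?_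
    have := abs_lt.mp (hx i)
    rw [hone (by linarith), hone (by linarith), one_mul]
  · exact (hx i).trans_lt (by linarith)

theorem cubeCutoff_mem_Icc (d : ℕ) (a : ℝ) (x : E d) :
    0 ≤ cubeCutoff d a x ∧ cubeCutoff d a x ≤ 1 := by
  have h0 (s : ℝ) : 0 ≤ faceProfile a s := Real.smoothTransition.nonneg _
  have h1 (s : ℝ) : faceProfile a s ≤ 1 := Real.smoothTransition.le_one _
  exact ⟨Finset.prod_nonneg fun i _ => mul_nonneg (h0 _) (h0 _),
    Finset.prod_le_one (fun i _ => mul_nonneg (h0 _) (h0 _)) fun i _ =>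
      mul_le_one₀ (h1 _) (h0 _) (h1 _)⟩

end Cutoffs

/-! ### The error estimate -/

section Estimate

open SchwartzMap LineDeriv

theorem contDiff_dilate {d : ℕ} {a : ℝ} {χ : E d → ℝ} (hχ : IsCutoff a χ) (L : ℝ) :
    ContDiff ℝ (⊤ : ℕ∞) (dilate L χ) :=
  hχ.smooth.comp (contDiff_const_smul _)

theorem tsupport_dilate_subset {d : ℕ} {a L : ℝ} (hL : 0 < L) {χ : E d → ℝ} (hχ : IsCutoff a χ) :
    tsupport (dilate L χ) ⊆ window d L := by
  refine closure_minimal (fun x hx i => ?_) (isCompact_window d L).isClosed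
  have h := hχ.support_subset (subset_tsupport _ hx) i
  rw [PiLp.smul_apply, smul_eq_mul, abs_mul, abs_inv, abs_of_pos hL, inv_mul_lt_iff₀ hL,
    mul_one] at h
  exact h.le

theorem dilate_eq_zero {d : ℕ} {a L : ℝ} (hL : 0 < L) {χ : E d → ℝ} (hχ : IsCutoff a χ) {x : E d}
    (hx : x ∉ window d L) : dilate L χ x = 0 :=
  image_eq_zero_of_notMem_tsupport fun h => hx (tsupport_dilate_subset hL hχ h)

/-- The dilated cut-off as a complex-valued Schwartz function. -/
def schwartzCutoff {d : ℕ} {a L : ℝ} (hL : 0 < L) {χ : E d → ℝ} (hχ : IsCutoff a χ) :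
    𝓢(E d, ℂ) :=
  HasCompactSupport.toSchwartzMap (f := fun x => (dilate L χ x : ℂ))
    (HasCompactSupport.comp_left (f := dilate L χ)
      ((isCompact_window d L).of_isClosed_subset (isClosed_tsupport _)
        (tsupport_dilate_subset hL hχ)) Complex.ofReal_zero)
    (Complex.ofRealCLM.contDiff.comp (contDiff_dilate hχ L))

@[simp]
theorem schwartzCutoff_apply {d : ℕ} {a L : ℝ} (hL : 0 < L) {χ : E d → ℝ} (hχ : IsCutoff a χ)
    (x : E d) : schwartzCutoff hL hχ x = (dilate L χ x : ℂ) := rfl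

theorem norm_iterate_lineDerivOp_schwartzCutoff_le {d m : ℕ} {K a L : ℝ} (hL : 0 < L)
    {χ : E d → ℝ} (hχ : IsCutoff a χ) (hK : LayerBound m K a χ) {v : E d} (hv : ‖v‖ ≤ 1) {j : ℕ}
    (hj : j ≤ m) (x : E d) :
    ‖(∂_{v}^[j] (schwartzCutoff hL hχ) : 𝓢(E d, ℂ)) x‖ ≤ K * ((((1 - a) * L)⁻¹) ^ j) := by
  rw [← iteratedLineDerivOp_const_eq_iter_lineDerivOp, iteratedLineDerivOp_eq_iteratedFDeriv]
  refine (ContinuousMultilinearMap.le_opNorm _ _).trans ?_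
  refine (mul_le_of_le_one_right (norm_nonneg _)
    (Finset.prod_le_one (fun _ _ => norm_nonneg _) fun _ _ => hv)).trans ?_
  have h1 : ‖iteratedFDeriv ℝ j (schwartzCutoff hL hχ) x‖ =
      ‖iteratedFDeriv ℝ j (dilate L χ) x‖ :=
    Complex.ofRealLI.norm_iteratedFDeriv_comp_left (contDiff_dilate hχ L).contDiffAt
      (mod_cast le_top)
  have h2 : iteratedFDeriv ℝ j (dilate L χ) x =
      (L⁻¹) ^ j • iteratedFDeriv ℝ j χ (L⁻¹ • x) :=
    congrFun (iteratedFDeriv_comp_const_smul L⁻¹ (hχ.smooth.of_le (mod_cast le_top))) x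
  rw [h1, h2, norm_smul, norm_pow, norm_inv, Real.norm_of_nonneg hL.le, mul_inv, mul_pow,
    mul_comm, ← mul_assoc]
  refine mul_le_mul_of_nonneg_right ?_ (by positivity)
  rw [inv_pow, ← zpow_natCast, ← zpow_neg]
  exact hK j hj _

theorem norm_dilate_le {d m : ℕ} {K a : ℝ} {χ : E d → ℝ} (hK : LayerBound m K a χ) (L : ℝ)
    (x : E d) : |dilate L χ x| ≤ K := by
  simpa [dilate] using hK 0 (Nat.zero_le _) (L⁻¹ • x)

theorem memLp_dilate_smul {d m : ℕ} {K a L : ℝ} {χ : E d → ℝ} (hχ : IsCutoff a χ)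
    (hK : LayerBound m K a χ) {μ : Measure (E d)} {f : E d → ℂ} (hf : MemLp f 2 μ) :
    MemLp (fun x => dilate L χ x • f x) 2 μ := by
  refine hf.of_le_mul (c := K)
    ((contDiff_dilate hχ L).continuous.aestronglyMeasurable.smul hf.1)
    (Filter.Eventually.of_forall fun x => ?_)
  rw [norm_smul, Real.norm_eq_abs]
  exact mul_le_mul_of_nonneg_right (norm_dilate_le hK L x) (norm_nonneg _)

/-- The spectral estimate for the product of the cut-off with a Sobolev function. The remainder of
the Fourier projection is a contraction of `L²`, so the estimate passes from Schwartz functions to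
their limits. -/
theorem eLpNorm_dilate_smul_sub_fourierProj_le {d γ : ℕ} {K a L : ℝ} (ha1 : a < 1)
    (hL : 0 < L) {N : ℕ} (hN : 1 ≤ N) {χ : E d → ℝ} (hχ : IsCutoff a χ)
    (hK : LayerBound γ K a χ) (f : L2 d) (hf : MemH (γ : ℝ) f) :
    eLpNorm (fun x => dilate L χ x • f x - fourierProj L N (fun x => dilate L χ x • f x) x) 2
        (volume.restrict (window d L)) ≤
      ENNReal.ofReal (d * ((N : ℝ) * L⁻¹) ^ (-(γ : ℤ)) *
        (K * (1 + ((1 - a) * L)⁻¹) ^ γ * sobolevNorm (γ : ℝ) f hf)) := by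
  have ha' : 0 < 1 - a := by linarith
  have hK0 : 0 ≤ K := (abs_nonneg _).trans (norm_dilate_le hK L 0)
  set M := ((1 - a) * L)⁻¹ with hM
  have hM0 : 0 ≤ M := by positivity
  set c := d * ((N : ℝ) * L⁻¹) ^ (-(γ : ℤ)) * (K * (1 + M) ^ γ) with hc
  have hc0 : 0 ≤ c := by positivity
  have key (ε : ℝ) (hε : 0 < ε) :
      eLpNorm (fun x => dilate L χ x • f x - fourierProj L N (fun x => dilate L χ x • f x) x) 2
        (volume.restrict (window d L)) ≤
      ENNReal.ofReal (c * sobolevNorm (γ : ℝ) f hf + (K + c) * ε) := by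
    obtain ⟨φ, h, hh, hS, hd⟩ := exists_schwartz_approx (by positivity) f hf hε
    set g : 𝓢(E d, ℂ) := smulLeftCLM ℂ (schwartzCutoff hL hχ) φ with hg
    have hgx (x : E d) : g x = dilate L χ x • φ x := by
      rw [hg, smulLeftCLM_apply_apply (schwartzCutoff hL hχ).hasTemperateGrowth,
        schwartzCutoff_apply, smul_eq_mul, Complex.real_smul]
    have hgsupp : tsupport g ⊆ window d L := by
      refine closure_minimal (fun x hx => ?_) (isCompact_window d L).isClosed
      by_contra hxw
      exact hx (by rw [hgx, dilate_eq_zero hL hχ hxw, zero_smul])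
    have hdiff : MemLp (fun x => f x - φ x) 2 (volume : Measure (E d)) :=
      (Lp.memLp f).sub (φ.memLp 2 volume)
    have m1 : MemLp (fun x => dilate L χ x • (f x - φ x)) 2 (volume.restrict (window d L)) :=
      (memLp_dilate_smul hχ hK hdiff).restrict _
    have m2 : MemLp g 2 (volume.restrict (window d L)) := (g.memLp 2 volume).restrict _
    have hsplit : (fun x => dilate L χ x • f x) =
        fun x => dilate L χ x • (f x - φ x) + g x := by
      ext x; rw [hgx, smul_sub, sub_add_cancel]
    have hrem : (fun x => dilate L χ x • f x - fourierProj L N (fun x => dilate L χ x • f x) x) =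
        (fun x => dilate L χ x • (f x - φ x) -
          fourierProj L N (fun x => dilate L χ x • (f x - φ x)) x) +
        fun x => g x - fourierProj L N g x := by
      ext x
      rw [Pi.add_apply, hsplit, fourierProj_add L N m1 m2, congrFun hsplit x]
      ring
    rw [hrem]
    refine (eLpNorm_add_le (m1.sub (memLp_fourierProj L N _)).1
      (m2.sub (memLp_fourierProj L N _)).1 one_le_two).trans ?_
    have e1 : eLpNorm (fun x => dilate L χ x • (f x - φ x) -
          fourierProj L N (fun x => dilate L χ x • (f x - φ x)) x) 2
          (volume.restrict (window d L)) ≤ ENNReal.ofReal (K * ε) := by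
      refine (eLpNorm_sub_fourierProj_le hL N m1).trans
        ((eLpNorm_mono_measure _ Measure.restrict_le_self).trans ?_)
      refine (eLpNorm_le_mul_eLpNorm_of_ae_le_mul (c := K) (g := fun x => f x - φ x)
        (Filter.Eventually.of_forall fun x => ?_) 2).trans ?_
      · rw [norm_smul, Real.norm_eq_abs]
        exact mul_le_mul_of_nonneg_right (norm_dilate_le hK L x) (norm_nonneg _)
      · rw [ENNReal.ofReal_mul hK0]
        refine mul_le_mul_right ?_ _
        rw [← ENNReal.ofReal_toReal hdiff.2.ne]
        refine ENNReal.ofReal_le_ofReal (le_trans (le_of_eq ?_) hd)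
        rw [Lp.norm_def]
        congr 1
        refine eLpNorm_congr_ae ?_
        filter_upwards [Lp.coeFn_sub f (φ.toLp 2 volume), φ.coeFn_toLp 2 volume] with x h1 h2
        rw [h1, Pi.sub_apply, h2]
    have e2 := eLpNorm_schwartz_sub_fourierProj_le hL hN γ g hgsupp
      (B := K * (1 + M) ^ γ * ‖h.toLp 2 volume‖) (by positivity) fun i => by
        have hv : ‖(EuclideanSpace.single i (1 : ℝ) : E d)‖ ≤ 1 := by simp
        exact norm_toLp_iterate_lineDerivOp_smul_le _ hM0 γ _ φ hK0
          (fun j hj x => norm_iterate_lineDerivOp_schwartzCutoff_le hL hχ hK hv hj x)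
          (fun j hj => norm_toLp_iterate_lineDerivOp_le hh hv hj)
    refine (add_le_add e1 e2).trans ?_
    rw [← ENNReal.ofReal_add (by positivity) (by positivity)]
    refine ENNReal.ofReal_le_ofReal ?_
    calc K * ε + d * ((N : ℝ) * L⁻¹) ^ (-(γ : ℤ)) * (K * (1 + M) ^ γ * ‖h.toLp 2 volume‖)
        = K * ε + c * ‖h.toLp 2 volume‖ := by rw [hc]; ring
      _ ≤ K * ε + c * (sobolevNorm (γ : ℝ) f hf + ε) := by gcongr
      _ = c * sobolevNorm (γ : ℝ) f hf + (K + c) * ε := by ring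
  have hlim : Filter.Tendsto
      (fun ε : ℝ => ENNReal.ofReal (c * sobolevNorm (γ : ℝ) f hf + (K + c) * ε))
      (nhdsWithin 0 (Set.Ioi 0)) (nhds (ENNReal.ofReal (c * sobolevNorm (γ : ℝ) f hf))) := by
    have hcont : Continuous
        (fun ε : ℝ => ENNReal.ofReal (c * sobolevNorm (γ : ℝ) f hf + (K + c) * ε)) :=
      ENNReal.continuous_ofReal.comp (by fun_prop)
    have := hcont.tendsto 0
    rw [mul_zero, add_zero] at this
    exact this.mono_left nhdsWithin_le_nhds
  have hle := ge_of_tendsto hlim (by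
    filter_upwards [self_mem_nhdsWithin] with ε hε using key ε hε)
  rwa [hc, mul_assoc] at hle

/-- The truncation error: `f` is cut off only where `‖x‖ ≥ a L`. -/
theorem eLpNorm_sub_dilate_smul_le {d γ : ℕ} {K a L : ℝ} (ha : 0 < a) (hL : 0 < L)
    {χ : E d → ℝ} (hχ : IsCutoff a χ) (hK : LayerBound γ K a χ) (f : E d → ℂ) :
    eLpNorm (fun x => f x - dilate L χ x • f x) 2 volume ≤
      ENNReal.ofReal ((1 + K) * (a * L) ^ (-(γ : ℤ))) *
        eLpNorm (fun x => ‖x‖ ^ γ • f x) 2 volume := by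
  refine eLpNorm_le_mul_eLpNorm_of_ae_le_mul (Filter.Eventually.of_forall fun x => ?_) 2
  have haL : 0 < a * L := by positivity
  have hK0 : 0 ≤ K := (abs_nonneg _).trans (norm_dilate_le hK L x)
  by_cases hx : ∀ i, |x i| < a * L
  · have h1 : dilate L χ x = 1 := by
      refine hχ.eq_one _ fun i => ?_
      rw [PiLp.smul_apply, smul_eq_mul, abs_mul, abs_inv, abs_of_pos hL, inv_mul_lt_iff₀ hL,
        mul_comm L a]
      exact hx i
    rw [h1, one_smul, sub_self, norm_zero]
    positivity
  · push Not at hx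
    obtain ⟨i, hi⟩ := hx
    have hxn : a * L ≤ ‖x‖ := hi.trans (PiLp.norm_apply_le x i)
    have h1 : ‖f x - dilate L χ x • f x‖ ≤ (1 + K) * ‖f x‖ := by
      rw [add_mul, one_mul]
      refine (norm_sub_le _ _).trans ?_
      rw [norm_smul, Real.norm_eq_abs]
      gcongr
      exact norm_dilate_le hK L x
    have h2 : 1 ≤ (a * L) ^ (-(γ : ℤ)) * ‖x‖ ^ γ := by
      rw [zpow_neg, zpow_natCast, ← inv_pow, ← mul_pow]
      exact one_le_pow₀ ((one_le_inv_mul₀ haL).mpr hxn)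
    rw [norm_smul, norm_pow, norm_norm]
    calc ‖f x - dilate L χ x • f x‖ ≤ (1 + K) * ‖f x‖ * 1 := by rw [mul_one]; exact h1
      _ ≤ (1 + K) * ‖f x‖ * ((a * L) ^ (-(γ : ℤ)) * ‖x‖ ^ γ) := by gcongr
      _ = (1 + K) * (a * L) ^ (-(γ : ℤ)) * (‖x‖ ^ γ * ‖f x‖) := by ring

theorem one_add_pow_le {M : ℝ} (hM : 0 ≤ M) (γ : ℕ) : (1 + M) ^ γ ≤ 2 ^ γ * (1 + M ^ γ) := by
  have h1 : 1 + M ≤ 2 * max 1 M := by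
    linarith [le_max_left 1 M, le_max_right 1 M]
  calc (1 + M) ^ γ ≤ (2 * max 1 M) ^ γ := pow_le_pow_left₀ (by positivity) h1 γ
    _ = 2 ^ γ * (max 1 M) ^ γ := mul_pow _ _ _
    _ ≤ 2 ^ γ * (1 + M ^ γ) := by
      gcongr
      rcases max_cases 1 M with ⟨h, _⟩ | ⟨h, _⟩ <;> rw [h]
      · rw [one_pow]; linarith [pow_nonneg hM γ]
      · linarith

/-- The error estimate with an explicit constant. -/
theorem approxEstimate_of_layerBound {d γ : ℕ} {K a : ℝ} (ha : 0 < a) (ha1 : a < 1)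
    {χ : E d → ℝ} (hχ : IsCutoff a χ) (hK : LayerBound γ K a χ) :
    ApproxEstimate d γ (1 + |K| + d * 2 ^ γ * |K|) a χ := by
  intro L hL N hN f hf hw
  have ha' : 0 < 1 - a := by linarith
  have hK0 : 0 ≤ K := (abs_nonneg _).trans (norm_dilate_le hK L 0)
  rw [abs_of_nonneg hK0]
  have hcut : MemLp (fun x => dilate L χ x • f x) 2 (volume : Measure (E d)) :=
    memLp_dilate_smul hχ hK (Lp.memLp f)
  have hsplit : (fun x => f x - windowApprox L N χ f x) =
      (fun x => f x - dilate L χ x • f x) + (window d L).indicator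
        (fun x => dilate L χ x • f x - fourierProj L N (fun x => dilate L χ x • f x) x) := by
    ext x
    rw [Pi.add_apply, windowApprox, zeroExt]
    by_cases hx : x ∈ window d L
    · rw [indicator_of_mem hx, indicator_of_mem hx]; ring
    · rw [indicator_of_notMem hx, indicator_of_notMem hx, dilate_eq_zero hL hχ hx]; simp
  rw [hsplit]
  refine (eLpNorm_add_le ((Lp.memLp f).sub hcut).1
    ((hcut.1.sub (continuous_fourierProj L N _).aestronglyMeasurable).indicator
      (measurableSet_window d L)) one_le_two).trans ?_
  rw [eLpNorm_indicator_eq_eLpNorm_restrict (measurableSet_window d L)]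
  have e1 := eLpNorm_sub_dilate_smul_le ha hL hχ hK f
  rw [← ENNReal.ofReal_toReal hw.2.ne, ← ENNReal.ofReal_mul (by positivity)] at e1
  refine (add_le_add e1 (eLpNorm_dilate_smul_sub_fourierProj_le ha1 hL hN hχ hK f hf)).trans ?_
  set W := (eLpNorm (fun x => ‖x‖ ^ γ • f x) 2 volume).toReal
  have hW : 0 ≤ W := ENNReal.toReal_nonneg
  set S := sobolevNorm (γ : ℝ) f hf
  have hS : 0 ≤ S := norm_nonneg _
  set q := ((N : ℝ) * L⁻¹) ^ (-(γ : ℤ))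
  have hq : 0 ≤ q := by positivity
  set p := (a * L) ^ (-(γ : ℤ))
  have hp : 0 ≤ p := by positivity
  have hM : ((1 - a) * L) ^ (-(γ : ℤ)) = (((1 - a) * L)⁻¹) ^ γ := by
    rw [zpow_neg, zpow_natCast, inv_pow]
  rw [hM]
  set M := ((1 - a) * L)⁻¹ with hMdef
  have hM0 : 0 ≤ M := by positivity
  rw [← ENNReal.ofReal_add (by positivity) (by positivity)]
  refine ENNReal.ofReal_le_ofReal (add_le_add ?_ ?_)
  · refine mul_le_mul_of_nonneg_right (mul_le_mul_of_nonneg_right ?_ hp) hW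
    have : 0 ≤ d * 2 ^ γ * K := by positivity
    linarith
  · calc d * q * (K * (1 + M) ^ γ * S) ≤ d * q * (K * (2 ^ γ * (1 + M ^ γ)) * S) := by
          gcongr
          exact one_add_pow_le hM0 γ
      _ = (d * 2 ^ γ * K) * (1 + M ^ γ) * q * S := by ring
      _ ≤ (1 + K + d * 2 ^ γ * K) * (1 + M ^ γ) * q * S := by
          gcongr
          linarith

end Estimate

end WindowApprox

end

theorem theorem4p1 (d γ : ℕ) (hd : 1 ≤ d) (hγ : 1 ≤ γ) :
    -- the constant depends only on `d`, `γ` and the layer constant `K` of the cut-off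
    (∀ K : ℝ, ∃ C : ℝ, 0 < C ∧ ∀ a : ℝ, 0 < a → a < 1 → ∀ χ : WindowApprox.E d → ℝ,
      WindowApprox.IsCutoff a χ → WindowApprox.LayerBound γ K a χ →
        WindowApprox.ApproxEstimate d γ C a χ) ∧
    -- an arbitrary fixed cut-off
    (∀ a : ℝ, 0 < a → a < 1 → ∀ χ : WindowApprox.E d → ℝ, WindowApprox.IsCutoff a χ →
      ∃ C : ℝ, 0 < C ∧ WindowApprox.ApproxEstimate d γ C a χ) ∧
    -- there is a family of cut-offs with layer constants independent of `a`, to all orders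
    (∃ χ : ℝ → WindowApprox.E d → ℝ,
      (∀ a : ℝ, 0 < a → a < 1 →
        WindowApprox.IsCutoff a (χ a) ∧ ∀ x, 0 ≤ χ a x ∧ χ a x ≤ 1) ∧
      ∀ m : ℕ, ∃ K : ℝ, ∀ a : ℝ, 0 < a → a < 1 → WindowApprox.LayerBound m K a (χ a)) := by
  have hC (K : ℝ) : 0 < 1 + |K| + d * 2 ^ γ * |K| := by positivity
  refine ⟨fun K => ⟨_, hC K, fun a ha ha1 χ hχ hK =>
    WindowApprox.approxEstimate_of_layerBound ha ha1 hχ hK⟩, fun a ha ha1 χ hχ => ?_,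
    WindowApprox.cubeCutoff d, fun a _ ha1 =>
      ⟨WindowApprox.isCutoff_cubeCutoff d ha1, WindowApprox.cubeCutoff_mem_Icc d a⟩,
    (WindowApprox.uniformLayerBound_cubeCutoff d).2⟩
  obtain ⟨K, hK⟩ := hχ.exists_layerBound ha ha1 γ
  exact ⟨_, hC K, WindowApprox.approxEstimate_of_layerBound ha ha1 hχ hK⟩
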